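/- **Theorem.** Fix $N\ge 1$, a noise variance $\sigma^2>0$, a probability distribution of a source $X$ on $[0,1)$ (for instance the uniform one), and a factor $\alpha\in(0,1)$. *The scheme.* A Torus Layer Scheme in $\mathbb R^{2N}$ is given by the following parameters: a $\delta>0$; finitely many ($M\ge 1$) unit vectors $c_1,\dots,c_M\in\mathbb R^N$ with positive coordinates and $\|c_j-c_k\|\ge 2\delta$ for $j\ne k$; and integer vectors $u_1,\dots,u_M\in\mathbb Z^N$, each with coprime entries, such that each closed curve $$s_k(x)=\Phi_{c_k}(2\pi x\,\hat u_k),\qquad \hat u_k=(c_{k1}u_{k1},\dots,c_{kN}u_{kN}),$$ has small-ball radius at least $\delta$. Here $\Phi_c(v)=\big(c_i\cos\tfrac{v_i}{c_i},\,c_i\sin\tfrac{v_i}{c_i}\big)_{i=1}^N$ parametrizes the flat torus $T_c\subset S^{2N-1}$. That a curve $s$ has small-ball radius at least $\delta$ means: for each $x$, every point at distance less than $\delta$ from $s(x)$ in the hyperplane through $s(x)$ orthogonal to the curve is at least as close to $s(x)$ as to any other point of the curve. *Encoding.* Let $L_k$ be the length of $s_k$ (over $0\le x\le 1$), $L=\sum_k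 L_k$, $I_k=\big[\tfrac1L\sum_{j<k}L_j,\tfrac1L\sum_{j\le k}L_j\big)$, and let $f_k$ be the increasing affine bijection of $I_k$ onto $[0,1)$. With channel power $P$, the value $x\in I_k$ is sent as $\sqrt P\,s_k(\alpha f_k(x))$; thus each closed curve is opened by the factor $\alpha$. *Decoding.* The received vector is $y=\sqrt P\,s_k(\alpha f_k(x))+z$, where $z\sim\mathcal N(0,\sigma^2 I_{2N})$ is independent of $X$. A decoder returns $\hat x=f_k^{-1}(t)$ (extended affinely to $t\in[0,1]$), where $k$ and $t\in[0,1]$ are chosen in one of the following two ways, with any rule for ties. - *Maximum likelihood decoding:* $(k,t)$ minimizes $\|y-\sqrt P\,s_k(\alpha t)\|$. - *Torus decoding:* write $y/\sqrt P=\big(\gamma_i\cos\tfrac{\theta_i}{c_{ki}},\,\gamma_i\sin\tfrac{\theta_i}{c_{ki}}\big)_{i}$ with $\gamma_i\ge 0$, where $k$ is such that $c_k$ is a word closest to $\gamma$; then $t$, together with some $n\in\mathbb Z^N$, minimizes $\|\theta-2\pi(\alpha t\,\hat u_k+\hat n)\|$, where $\hat n=(c_{k1}n_1,\dots,c_{kN}n_N)$.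 *Claim.* There is a choice of the parameters ($\delta$, $M$, $c_k$, $u_k$) as a function of $P$ such that, for every $\mu>0$, the mean squared error $E[(X-\hat X)^2]$ is $O\big(P^{-(2N-1)+\mu}\big)$ as $P\to\infty$, both for maximum likelihood decoding and for torus decoding. -/

import Mathlib

open MeasureTheory ProbabilityTheory

noncomputable section

namespace TorusLayer

/-- The signal space `ℝ^{2N}`, with its `2N` coordinates grouped into `N` consecutive pairs. -/
abbrev Signal (N : ℕ) : Type := EuclideanSpace ℝ (Fin N × Fin 2)

/-- The map `Φ_c : ℝ^N → ℝ^{2N}` whose `i`-th pair of coordinates is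
`c_i (cos (v_i / c_i), sin (v_i / c_i))`. Its image is the flat torus `T_c`. -/
def flatTorusMap {N : ℕ} (c v : EuclideanSpace ℝ (Fin N)) : Signal N :=
  WithLp.toLp 2 fun p =>
    if p.2 = 0 then c p.1 * Real.cos (v p.1 / c p.1) else c p.1 * Real.sin (v p.1 / c p.1)

/-- For an integer vector `n`, the vector `n̂ = (c_1 n_1, …, c_N n_N)` of the rectangular lattice
`c_1 ℤ ⊕ … ⊕ c_N ℤ`. -/
def hat {N : ℕ} (c : EuclideanSpace ℝ (Fin N)) (n : Fin N → ℤ) : EuclideanSpace ℝ (Fin N) :=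
  WithLp.toLp 2 fun i => c i * (n i : ℝ)

/-- The curve `x ↦ Φ_c(2π x û)` on the flat torus `T_c`. -/
def curve {N : ℕ} (c : EuclideanSpace ℝ (Fin N)) (u : Fin N → ℤ) (x : ℝ) : Signal N :=
  flatTorusMap c ((2 * Real.pi * x) • hat c u)

/-- The length of a (smooth) curve with domain `[0, 1]`: the integral of its stretch. -/
def curveLength {N : ℕ} (s : ℝ → Signal N) : ℝ :=
  ∫ x in (0 : ℝ)..1, ‖deriv s x‖

/-- The curve `s` has small-ball radius at least `r`: at each of its points `s x`, every point `p`
of the open ball of radius `r` about `s x` that lies in the hyperplane through `s x` orthogonal to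
the curve belongs to the Voronoi region of `s x`. -/
def SmallBallRadiusAtLeast {N : ℕ} (s : ℝ → Signal N) (r : ℝ) : Prop :=
  ∀ (x : ℝ) (p : Signal N), ‖p - s x‖ < r → inner ℝ (p - s x) (deriv s x) = 0 →
    ∀ y : ℝ, ‖p - s x‖ ≤ ‖p - s y‖

/-- The design parameters of the Torus Layer Scheme in `ℝ^{2N}`. -/
structure Layers (N : ℕ) where
  /-- the target small-ball radius -/
  δ : ℝ
  δ_pos : 0 < δ
  /-- the number of layers -/
  M : ℕ
  M_pos : 0 < M
  /-- the spherical code whose words determine the tori -/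
  c : Fin M → EuclideanSpace ℝ (Fin N)
  c_pos : ∀ k i, 0 < c k i
  c_norm : ∀ k, ‖c k‖ = 1
  c_sep : ∀ j k, j ≠ k → 2 * δ ≤ dist (c j) (c k)
  /-- the integer vectors that determine the curves -/
  u : Fin M → Fin N → ℤ
  u_primitive : ∀ k, Finset.univ.gcd (u k) = 1
  curve_smallBall : ∀ k, SmallBallRadiusAtLeast (curve (c k) (u k)) δ

namespace Layers

variable {N : ℕ} (S : Layers N)

/-- The length `L_k` of the `k`-th curve. -/
def len (k : Fin S.M) : ℝ := curveLength (curve (S.c k) (S.u k))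

/-- The total length `L`. -/
def totalLen : ℝ := ∑ k, S.len k

/-- The left endpoint `(L_1 + ⋯ + L_{k-1}) / L` of the interval `I_k`. -/
def left (k : Fin S.M) : ℝ := (∑ j ∈ Finset.Iio k, S.len j) / S.totalLen

/-- The interval `I_k ⊆ [0, 1)`, whose length is `L_k / L`. -/
def interval (k : Fin S.M) : Set ℝ := Set.Ico (S.left k) (S.left k + S.len k / S.totalLen)

/-- The linear bijection `f_k` that takes `I_k` onto `[0, 1)`. -/
def coord (k : Fin S.M) (x : ℝ) : ℝ := (x - S.left k) / (S.len k / S.totalLen)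

/-- The inverse of `coord`: the source value with coordinate `t` on the `k`-th curve. -/
def value (k : Fin S.M) (t : ℝ) : ℝ := S.left k + t * (S.len k / S.totalLen)

/-- The transmitted point for the coordinate `t ∈ [0, 1]` on the `k`-th layer, with channel power
`P`. The closed curve is opened by the factor `α`: only its portion over `[0, α]` is used. -/
def point (α P : ℝ) (k : Fin S.M) (t : ℝ) : Signal N :=
  Real.sqrt P • curve (S.c k) (S.u k) (α * t)

/-- The encoding map: `x ∈ I_k` is sent to `√P s_k(α f_k(x))`. The intervals `I_k` are disjoint,
so that at most one term of the sum is nonzero. -/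
def encode (α P x : ℝ) : Signal N :=
  ∑ k, (S.interval k).indicator (fun x => S.point α P k (S.coord k x)) x

/-- Maximum likelihood decoding: the estimate is the source value of a point of the (closed) signal
locus at minimal distance from the received vector. -/
def IsMLDecoder (α P : ℝ) (xhat : Signal N → ℝ) : Prop :=
  ∀ y : Signal N, ∃ k, ∃ t ∈ Set.Icc (0 : ℝ) 1, xhat y = S.value k t ∧
    ∀ j, ∀ t' ∈ Set.Icc (0 : ℝ) 1, ‖y - S.point α P k t‖ ≤ ‖y - S.point α P j t'‖

/-- The vector `γ` of the norms of the `N` pairs of coordinates of `y`. -/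
def radii (y : Signal N) : EuclideanSpace ℝ (Fin N) :=
  WithLp.toLp 2 fun i => Real.sqrt (y (i, 0) ^ 2 + y (i, 1) ^ 2)

/-- Torus decoding, in two steps: the received vector, rescaled to power one, has radii `γ` and
angles `θ_i / c_i`; one first takes a layer `k` whose word `c = c_k` is closest to `γ`, and then a
point `2π(α t û + n̂)` closest to `θ` in `ℝ^N` among the lifts of the `k`-th opened curve through
the (periodic) map `Φ_c`. -/
def IsTorusDecoder (α P : ℝ) (xhat : Signal N → ℝ) : Prop :=
  ∀ y : Signal N, ∃ k, ∃ t ∈ Set.Icc (0 : ℝ) 1, xhat y = S.value k t ∧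
    (∀ j, dist (radii ((Real.sqrt P)⁻¹ • y)) (S.c k) ≤
      dist (radii ((Real.sqrt P)⁻¹ • y)) (S.c j)) ∧
    ∃ θ : EuclideanSpace ℝ (Fin N),
      (∀ i, ((Real.sqrt P)⁻¹ • y) (i, 0) =
          radii ((Real.sqrt P)⁻¹ • y) i * Real.cos (θ i / S.c k i) ∧
        ((Real.sqrt P)⁻¹ • y) (i, 1) =
          radii ((Real.sqrt P)⁻¹ • y) i * Real.sin (θ i / S.c k i)) ∧
      ∃ n : Fin N → ℤ, ∀ t' ∈ Set.Icc (0 : ℝ) 1, ∀ n' : Fin N → ℤ,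
        ‖θ - (2 * Real.pi) • ((α * t) • hat (S.c k) (S.u k) + hat (S.c k) n)‖ ≤
          ‖θ - (2 * Real.pi) • ((α * t') • hat (S.c k) (S.u k) + hat (S.c k) n')‖

end Layers

/-- The law of the channel noise: `2N` independent centered Gaussians of variance `σ²`. -/
def noise (N : ℕ) (σ : ℝ) : Measure (Signal N) :=
  (Measure.pi fun _ : Fin N × Fin 2 => gaussianReal 0 (σ ^ 2).toNNReal).map (WithLp.toLp 2)

/-- The mean squared error `E[(X - X̂)²]`, with `X` of law `ν` and `X̂` the estimate made from the
sum of the encoded value of `X` and an independent noise vector. -/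
def mse {N : ℕ} (S : Layers N) (ν : Measure ℝ) (σ α P : ℝ) (xhat : Signal N → ℝ) : ENNReal :=
  ∫⁻ x, ∫⁻ z, ENNReal.ofReal ((x - xhat (S.encode α P x + z)) ^ 2) ∂(noise N σ) ∂ν

end TorusLayer

end

/-!
The mean squared error has two sources. While the noise, rescaled by `1 / √P`, stays in a ball of
radius `δ`, the decoder finds the right layer and the right fold of the curve, and the error is the
noise divided by the stretch `√P L` of the encoder, where `L` is the total length of the curves;
this contributes `O(1 / (P L²))`. The other source is the event that the noise leaves that ball.
With `δ = log P / √P` this event has superpolynomially small probability (a Chernoff bound with an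
arbitrary parameter), so the exponent `-(2N-1)` follows once `L` is at least of the order of
`δ^(-(2N-2))`, which is the largest possible order by a volume count.

Write `N = n + 1`. Such schemes are explicit (`exists_layers`). The words are central projections to
the sphere of a grid of mesh of the order of `δ` in the hyperplane `w_0 = 1`, which gives about
`δ^(-n)` of them, all with coordinates at least a constant `a`. All layers use the direction
`u = (1, m, …, m^n)` with `m` of the order of `1 / δ`, so that each curve has length of the order of
`m^n`.

Everything rests on two facts. On a flat torus, chords are comparable to geodesics
(`exists_norm_sub_hat_le`). And if a lattice vector is close to the line spanned by `û`, then it is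
a multiple of `û` (`exists_eq_mul_of_norm_lt`): a point close to `x (1, m, …, m^n)` has
`n_{i+1} - m n_i` of absolute value less than one, hence zero. Together they say that points of a
curve at distance less than `2 δ` in space are close in parameter up to a period
(`exists_norm_mul_abs_sub_le`). This yields the small-ball radius, by a second-order Taylor
expansion, and, as tori of different layers are at distance at least `2 δ`, also the analysis of
both decoders. The factor `α < 1` excludes a nonzero period in the decoded parameter
(`abs_value_sub_value_le`).
-/

namespace TorusLayer

/-! ### Flat tori and the curves on them -/

variable {N : ℕ}

lemma Signal.norm_sq_eq (y : Signal N) : ‖y‖ ^ 2 = ∑ i, (y (i, 0) ^ 2 + y (i, 1) ^ 2) := by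
  rw [EuclideanSpace.real_norm_sq_eq, Fintype.sum_prod_type]
  simp [Fin.sum_univ_two]

lemma flatTorusMap_zero (c v : EuclideanSpace ℝ (Fin N)) (i : Fin N) :
    flatTorusMap c v (i, 0) = c i * Real.cos (v i / c i) := by
  simp [flatTorusMap]

lemma flatTorusMap_one (c v : EuclideanSpace ℝ (Fin N)) (i : Fin N) :
    flatTorusMap c v (i, 1) = c i * Real.sin (v i / c i) := by
  simp [flatTorusMap]

lemma hat_apply (c : EuclideanSpace ℝ (Fin N)) (n : Fin N → ℤ) (i : Fin N) :
    hat c n i = c i * n i := rfl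

lemma curve_zero {c : EuclideanSpace ℝ (Fin N)} (hc : ∀ i, 0 < c i) (u : Fin N → ℤ) (x : ℝ)
    (i : Fin N) : curve c u x (i, 0) = c i * Real.cos (2 * Real.pi * x * u i) := by
  have := (hc i).ne'
  rw [curve, flatTorusMap_zero]
  congr 2
  simp only [PiLp.smul_apply, hat_apply, smul_eq_mul]
  field_simp

lemma curve_one {c : EuclideanSpace ℝ (Fin N)} (hc : ∀ i, 0 < c i) (u : Fin N → ℤ) (x : ℝ)
    (i : Fin N) : curve c u x (i, 1) = c i * Real.sin (2 * Real.pi * x * u i) := by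
  have := (hc i).ne'
  rw [curve, flatTorusMap_one]
  congr 2
  simp only [PiLp.smul_apply, hat_apply, smul_eq_mul]
  field_simp

lemma norm_sq_flatTorusMap_sub (c v v' : EuclideanSpace ℝ (Fin N)) :
    ‖flatTorusMap c v - flatTorusMap c v'‖ ^ 2 =
      ∑ i, c i ^ 2 * (2 - 2 * Real.cos (v i / c i - v' i / c i)) := by
  rw [Signal.norm_sq_eq]
  refine Finset.sum_congr rfl fun i _ => ?_
  simp only [PiLp.sub_apply, flatTorusMap_zero, flatTorusMap_one, Real.cos_sub]
  linear_combination c i ^ 2 * Real.sin_sq_add_cos_sq (v i / c i) +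
    c i ^ 2 * Real.sin_sq_add_cos_sq (v' i / c i)

/-- Up to the factor `π / 2`, chords of the flat torus are as long as its geodesics: the bound
`cos d ≤ 1 - 2 d² / π²` on `[-π, π]`, in each coordinate plane. -/
lemma exists_norm_sub_hat_le {c : EuclideanSpace ℝ (Fin N)} (hc : ∀ i, 0 < c i)
    (v v' : EuclideanSpace ℝ (Fin N)) :
    ∃ n : Fin N → ℤ, ‖v - v' - (2 * Real.pi) • hat c n‖ ≤
      Real.pi / 2 * ‖flatTorusMap c v - flatTorusMap c v'‖ := by
  have hpi := Real.pi_pos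
  refine ⟨fun i => round ((v i / c i - v' i / c i) / (2 * Real.pi)), ?_⟩
  refine le_of_sq_le_sq ?_ (by positivity)
  rw [mul_pow, norm_sq_flatTorusMap_sub, EuclideanSpace.real_norm_sq_eq, Finset.mul_sum]
  refine Finset.sum_le_sum fun i _ => ?_
  set e := v i / c i - v' i / c i with he
  set n := round (e / (2 * Real.pi)) with hn
  have hci := (hc i).ne'
  have h1 : |e - n * (2 * Real.pi)| ≤ Real.pi := by
    have h := abs_sub_round (e / (2 * Real.pi))
    have h2 : e - n * (2 * Real.pi) = (e / (2 * Real.pi) - n) * (2 * Real.pi) := by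
      field_simp
    rw [h2, abs_mul, abs_of_pos (by positivity : 0 < 2 * Real.pi)]
    nlinarith
  have h3 := Real.cos_le_one_sub_mul_cos_sq h1
  rw [Real.cos_sub_int_mul_two_pi] at h3
  have h4 : (v - v' - (2 * Real.pi) • hat c fun i =>
      round ((v i / c i - v' i / c i) / (2 * Real.pi))) i = c i * (e - n * (2 * Real.pi)) := by
    simp only [PiLp.sub_apply, PiLp.smul_apply, hat_apply, smul_eq_mul]
    rw [← he, ← hn, he]
    field_simp
  rw [h4, mul_pow]
  have h5 : (Real.pi / 2) ^ 2 * (2 * (2 / Real.pi ^ 2 * (e - n * (2 * Real.pi)) ^ 2)) =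
      (e - n * (2 * Real.pi)) ^ 2 := by
    field_simp
  have h6 : (e - n * (2 * Real.pi)) ^ 2 ≤ (Real.pi / 2) ^ 2 * (2 - 2 * Real.cos e) := by
    rw [← h5]
    gcongr
    linarith
  nlinarith [sq_nonneg (c i)]

/-! ### The direction `(1, m, …, m^(N-1))` -/

/-- The lines through the points of `c_1 ℤ ⊕ … ⊕ c_N ℤ` in the direction of the rescaled vector
`(1, m, …, m^(N-1))` are well separated: if `x m^i` is within less than `1 / (m + 1)` of `k_i` for
all `i`, then `k_{i+1} - m k_i` is an integer of absolute value less than one, so that `k` is a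
multiple of `(1, m, …, m^(N-1))`. -/
lemma exists_eq_mul_of_norm_lt {n : ℕ} {c : EuclideanSpace ℝ (Fin (n + 1))} {a δ : ℝ} (ha : 0 < a)
    (hc : ∀ i, a ≤ c i) {m : ℕ} (hm : 1 ≤ m) (hδ : 2 * m * δ ≤ a) {x : ℝ}
    {k : Fin (n + 1) → ℤ}
    (h : ‖x • hat c (fun i => (m : ℤ) ^ (i : ℕ)) - hat c k‖ < δ) :
    ∃ q : ℤ, ∀ i, k i = q * (m : ℤ) ^ (i : ℕ) := by
  have hm' : (1 : ℝ) ≤ m := by exact_mod_cast hm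
  have key : ∀ i : Fin (n + 1), 2 * m * |x * m ^ (i : ℕ) - k i| < 1 := by
    intro i
    have h1 := (PiLp.norm_apply_le (x • hat c (fun i => (m : ℤ) ^ (i : ℕ)) - hat c k) i).trans_lt h
    have h2 : (x • hat c (fun i => (m : ℤ) ^ (i : ℕ)) - hat c k) i =
        c i * (x * m ^ (i : ℕ) - k i) := by
      simp only [PiLp.sub_apply, PiLp.smul_apply, hat_apply, smul_eq_mul]
      push_cast
      ring
    rw [h2, Real.norm_eq_abs, abs_mul, abs_of_pos (ha.trans_le (hc i))] at h1
    have h3 : a * |x * m ^ (i : ℕ) - k i| < δ :=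
      (mul_le_mul_of_nonneg_right (hc i) (abs_nonneg _)).trans_lt h1
    have h4 : a * (2 * m * |x * m ^ (i : ℕ) - k i|) < a * 1 := by
      calc _ = 2 * m * (a * |x * m ^ (i : ℕ) - k i|) := by ring
        _ < 2 * m * δ := by gcongr
        _ ≤ a * 1 := by linarith
    exact lt_of_mul_lt_mul_left h4 ha.le
  refine ⟨k 0, fun i => ?_⟩
  induction i using Fin.induction with
  | zero => simp
  | succ i ih =>
    have h1 := key i.castSucc
    have h2 := key i.succ
    have h3 : |((k i.succ - m * k i.castSucc : ℤ) : ℝ)| < 1 := by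
      have h4 : ((k i.succ - m * k i.castSucc : ℤ) : ℝ) =
          m * (x * m ^ (i.castSucc : ℕ) - k i.castSucc) - (x * m ^ (i.succ : ℕ) - k i.succ) := by
        push_cast [Fin.val_succ, Fin.val_castSucc]
        ring
      rw [h4]
      refine (norm_sub_le (E := ℝ) _ _).trans_lt ?_
      rw [Real.norm_eq_abs, Real.norm_eq_abs, abs_mul, abs_of_pos (by linarith : (0 : ℝ) < m)]
      nlinarith [abs_nonneg (x * m ^ (i.succ : ℕ) - k i.succ)]
    have h5 : k i.succ - m * k i.castSucc = 0 := by
      rw [← Int.abs_lt_one_iff]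
      exact_mod_cast h3
    rw [sub_eq_zero.mp h5, ih, Fin.val_succ, Fin.val_castSucc]
    ring

/-- Nearby points of the curve in the direction `(1, m, …, m^(N-1))` have nearby parameters, up to
an integer period. -/
lemma exists_norm_mul_abs_sub_le {n : ℕ} {c : EuclideanSpace ℝ (Fin (n + 1))} {a δ : ℝ}
    (ha : 0 < a) (hc : ∀ i, a ≤ c i) {m : ℕ} (hm : 1 ≤ m) (hδ : 2 * m * δ ≤ a) {x y : ℝ}
    (h : ‖curve c (fun i => (m : ℤ) ^ (i : ℕ)) x - curve c (fun i => (m : ℤ) ^ (i : ℕ)) y‖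
      < 2 * δ) :
    ∃ q : ℤ, ‖hat c (fun i => (m : ℤ) ^ (i : ℕ))‖ * |x - y - q| ≤
      ‖curve c (fun i => (m : ℤ) ^ (i : ℕ)) x - curve c (fun i => (m : ℤ) ^ (i : ℕ)) y‖ / 4 := by
  obtain ⟨k, hk⟩ := exists_norm_sub_hat_le (fun i => ha.trans_le (hc i))
    ((2 * Real.pi * x) • hat c (fun i => (m : ℤ) ^ (i : ℕ)))
    ((2 * Real.pi * y) • hat c (fun i => (m : ℤ) ^ (i : ℕ)))
  rw [← curve, ← curve] at hk
  set D := ‖curve c (fun i => (m : ℤ) ^ (i : ℕ)) x - curve c (fun i => (m : ℤ) ^ (i : ℕ)) y‖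
  set w := hat c (fun i => (m : ℤ) ^ (i : ℕ)) with hw
  have e1 : (2 * Real.pi * x) • w - (2 * Real.pi * y) • w - (2 * Real.pi) • hat c k =
      (2 * Real.pi) • ((x - y) • w - hat c k) := by
    module
  rw [e1, norm_smul, Real.norm_of_nonneg (by positivity)] at hk
  have h1 : ‖(x - y) • w - hat c k‖ ≤ D / 4 := by
    refine le_of_mul_le_mul_left (a := 2 * Real.pi) ?_ (by positivity)
    linarith
  obtain ⟨q, hq⟩ := exists_eq_mul_of_norm_lt ha hc hm hδ
    (h1.trans_lt (by linarith [norm_nonneg ((x - y) • w - hat c k)] : D / 4 < δ))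
  refine ⟨q, ?_⟩
  have e2 : hat c k = (q : ℝ) • w := by
    ext i
    simp only [hw, PiLp.smul_apply, hat_apply, smul_eq_mul, hq i]
    push_cast
    ring
  rwa [e2, ← sub_smul, norm_smul, Real.norm_eq_abs, mul_comm] at h1

lemma hasDerivAt_curve {c : EuclideanSpace ℝ (Fin N)} (hc : ∀ i, 0 < c i) (u : Fin N → ℤ)
    (x : ℝ) :
    HasDerivAt (curve c u) (WithLp.toLp 2 fun p =>
      if p.2 = 0 then -(2 * Real.pi * (c p.1 * u p.1) * Real.sin (2 * Real.pi * x * u p.1))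
      else 2 * Real.pi * (c p.1 * u p.1) * Real.cos (2 * Real.pi * x * u p.1)) x := by
  refine (PiLp.hasFDerivAt_toLp 2 (WithLp.ofLp (curve c u x))).comp_hasDerivAt x
    (f := fun x => WithLp.ofLp (curve c u x)) (hasDerivAt_pi.mpr ?_)
  rintro ⟨i, j⟩
  have h0 : HasDerivAt (fun x : ℝ => 2 * Real.pi * x * u i) (2 * Real.pi * u i) x := by
    simpa using ((hasDerivAt_id x).const_mul (2 * Real.pi)).mul_const (u i : ℝ)
  fin_cases j
  · simp only [curve_zero hc, Fin.zero_eta]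
    refine (h0.cos.const_mul (c i)).congr_deriv ?_
    simp
    ring
  · simp only [curve_one hc, Fin.mk_one]
    refine (h0.sin.const_mul (c i)).congr_deriv ?_
    simp
    ring

lemma curveLength_curve {c : EuclideanSpace ℝ (Fin N)} (hc : ∀ i, 0 < c i) (u : Fin N → ℤ) :
    curveLength (curve c u) = 2 * Real.pi * ‖hat c u‖ := by
  have h : ∀ x, ‖deriv (curve c u) x‖ = 2 * Real.pi * ‖hat c u‖ := by
    intro x
    rw [(hasDerivAt_curve hc u x).deriv]
    refine (sq_eq_sq₀ (norm_nonneg _) (by positivity)).mp ?_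
    rw [Signal.norm_sq_eq, mul_pow, EuclideanSpace.real_norm_sq_eq, Finset.mul_sum]
    refine Finset.sum_congr rfl fun i _ => ?_
    simp only [if_true, one_ne_zero, if_false, hat_apply]
    linear_combination (2 * Real.pi * (c i * u i)) ^ 2 *
      Real.sin_sq_add_cos_sq (2 * Real.pi * x * u i)
  simp [curveLength, h]

/-! ### The small-ball radius -/

lemma abs_cos_sub_one_le (b : ℝ) : |Real.cos b - 1| ≤ b ^ 2 := by
  rw [abs_of_nonpos (by linarith [Real.cos_le_one b])]
  nlinarith [Real.one_sub_sq_div_two_le_cos (x := b), sq_nonneg b]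

lemma abs_sin_sub_self_le {b : ℝ} (hb : |b| ≤ 1) : |Real.sin b - b| ≤ b ^ 2 := by
  rw [abs_sub_comm, ← sq_abs]
  refine (Real.abs_sub_sin_le b).trans ?_
  have h : |b| ^ 3 ≤ |b| ^ 2 := pow_le_pow_of_le_one (abs_nonneg b) hb (by norm_num)
  linarith [pow_nonneg (abs_nonneg b) 3]

/-- The second-order Taylor bound for `b ↦ (cos (t + b), sin (t + b))`, paired with a vector. -/
lemma taylor_pair_le {b : ℝ} (hb : |b| ≤ 1) (t p q r : ℝ) (hp : |p| ≤ r) (hq : |q| ≤ r) :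
    p * (Real.cos (t + b) - Real.cos t + b * Real.sin t) +
      q * (Real.sin (t + b) - Real.sin t - b * Real.cos t) ≤ 4 * r * b ^ 2 := by
  have hr : 0 ≤ r := (abs_nonneg p).trans hp
  have h1 := abs_cos_sub_one_le b
  have h2 := abs_sin_sub_self_le hb
  have key : ∀ s t : ℝ, |s| ≤ 1 → |t| ≤ 1 →
      |s * (Real.cos b - 1) + t * (Real.sin b - b)| ≤ 2 * b ^ 2 := by
    intro s t hs ht
    refine (abs_add_le _ _).trans ?_
    rw [abs_mul, abs_mul]
    nlinarith [mul_le_mul hs h1 (abs_nonneg _) zero_le_one,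
      mul_le_mul ht h2 (abs_nonneg _) zero_le_one]
  have k1 := key (Real.cos t) (-Real.sin t) (Real.abs_cos_le_one t)
    (by rw [abs_neg]; exact Real.abs_sin_le_one t)
  have k2 := key (Real.sin t) (Real.cos t) (Real.abs_sin_le_one t) (Real.abs_cos_le_one t)
  have e1 : Real.cos (t + b) - Real.cos t + b * Real.sin t =
      Real.cos t * (Real.cos b - 1) + -Real.sin t * (Real.sin b - b) := by
    rw [Real.cos_add]; ring
  have e2 : Real.sin (t + b) - Real.sin t - b * Real.cos t =
      Real.sin t * (Real.cos b - 1) + Real.cos t * (Real.sin b - b) := by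
    rw [Real.sin_add]; ring
  rw [e1, e2]
  have m1 := mul_le_mul hp k1 (abs_nonneg _) hr
  have m2 := mul_le_mul hq k2 (abs_nonneg _) hr
  rw [← abs_mul] at m1 m2
  linarith [le_abs_self (p * (Real.cos t * (Real.cos b - 1) + -Real.sin t * (Real.sin b - b))),
    le_abs_self (q * (Real.sin t * (Real.cos b - 1) + Real.cos t * (Real.sin b - b)))]

/-- The curve in the direction `(1, m, …, m^(N-1))` has small-ball radius of the order of `1 / m`.
Points of the curve at distance at least `2 δ` are no threat by the triangle inequality. Closer ones
are, up to a period, close in parameter, and there the quadratic growth of the chord beats the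
curvature, as `δ` is small against the radii of the torus. -/
lemma smallBallRadiusAtLeast_curve {n : ℕ} {c : EuclideanSpace ℝ (Fin (n + 1))} {a δ : ℝ}
    (ha : 0 < a) (hc : ∀ i, a ≤ c i) {m : ℕ} (hm : 1 ≤ m) (hδ0 : 0 < δ) (hδ : 40 * m * δ ≤ a) :
    SmallBallRadiusAtLeast (curve c (fun i => (m : ℤ) ^ (i : ℕ))) δ := by
  intro x p hp hperp y
  set u : Fin (n + 1) → ℤ := fun i => (m : ℤ) ^ (i : ℕ) with hu
  have hc0 : ∀ i, 0 < c i := fun i => ha.trans_le (hc i)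
  have hm' : (1 : ℝ) ≤ m := by exact_mod_cast hm
  have hδa : 40 * δ ≤ a := by nlinarith
  set D := ‖curve c u y - curve c u x‖ with hD
  rcases le_or_gt (2 * δ) D with hbig | hsmall
  · have h1 := norm_sub_le (p - curve c u x) (p - curve c u y)
    rw [sub_sub_sub_cancel_left, ← hD] at h1
    linarith
  obtain ⟨q, hq⟩ := exists_norm_mul_abs_sub_le ha hc hm (by nlinarith) hsmall
  rw [← hu, ← hD] at hq
  -- `b i` is the difference of the angles of the two points in the `i`-th plane, modulo `2 π`.
  set h : ℝ := y - x - q with hh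
  set b : Fin (n + 1) → ℝ := fun i => 2 * Real.pi * h * u i with hb
  have hb1 : ∀ i, |b i| ≤ 1 := by
    intro i
    have h1 : ‖hat c u i‖ ≤ ‖hat c u‖ := PiLp.norm_apply_le _ i
    rw [hat_apply, Real.norm_eq_abs, abs_mul, abs_of_pos (hc0 i)] at h1
    have h2 : a * (|(u i : ℝ)| * |h|) ≤ δ / 2 := by
      calc a * (|(u i : ℝ)| * |h|) ≤ c i * (|(u i : ℝ)| * |h|) := by
            gcongr
            exact hc i
        _ = c i * |(u i : ℝ)| * |h| := by ring
        _ ≤ ‖hat c u‖ * |h| := by gcongr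
        _ ≤ δ / 2 := by linarith
    have h3 : |b i| = 2 * Real.pi * (|(u i : ℝ)| * |h|) := by
      simp only [hb]
      rw [abs_mul, abs_mul, abs_of_pos (by positivity : 0 < 2 * Real.pi)]
      ring
    rw [h3]
    have hpi := Real.pi_lt_four
    have h0 : 0 ≤ |(u i : ℝ)| * |h| := by positivity
    have h4 : a * (|(u i : ℝ)| * |h|) ≤ a * (1 / 80) := by linarith
    have h5 := le_of_mul_le_mul_left h4 ha
    nlinarith
  have ecos : ∀ i, Real.cos (2 * Real.pi * y * u i) = Real.cos (2 * Real.pi * x * u i + b i) := by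
    intro i
    rw [← Real.cos_sub_int_mul_two_pi (2 * Real.pi * y * u i) (q * u i)]
    congr 1
    simp only [hb, hh]
    push_cast
    ring
  have esin : ∀ i, Real.sin (2 * Real.pi * y * u i) = Real.sin (2 * Real.pi * x * u i + b i) := by
    intro i
    rw [← Real.sin_sub_int_mul_two_pi (2 * Real.pi * y * u i) (q * u i)]
    congr 1
    simp only [hb, hh]
    push_cast
    ring
  refine le_of_sq_le_sq ?_ (norm_nonneg _)
  rw [(hasDerivAt_curve hc0 u x).deriv, PiLp.inner_apply, Fintype.sum_prod_type] at hperp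
  have hperp' : ∑ i, (p (i, 0) - curve c u x (i, 0)) *
        (b i * (c i * Real.sin (2 * Real.pi * x * u i))) -
      ∑ i, (p (i, 1) - curve c u x (i, 1)) *
        (b i * (c i * Real.cos (2 * Real.pi * x * u i))) = 0 := by
    rw [← Finset.sum_sub_distrib]
    refine Eq.trans ?_ ((congrArg (fun r => -h * r) hperp).trans (mul_zero _))
    rw [Finset.mul_sum]
    refine Finset.sum_congr rfl fun i _ => ?_
    simp [Fin.sum_univ_two, hb]
    ring
  refine sub_nonneg.mp ?_
  -- The linear terms, which vanish as `p - s x` is orthogonal to the curve, are subtracted so that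
  -- the summands become nonnegative one by one.
  have hsum : ‖p - curve c u y‖ ^ 2 - ‖p - curve c u x‖ ^ 2 = ∑ i,
      (((p - curve c u y) (i, 0) ^ 2 + (p - curve c u y) (i, 1) ^ 2) -
        ((p - curve c u x) (i, 0) ^ 2 + (p - curve c u x) (i, 1) ^ 2) -
        2 * ((p (i, 0) - curve c u x (i, 0)) *
            (b i * (c i * Real.sin (2 * Real.pi * x * u i))) -
          (p (i, 1) - curve c u x (i, 1)) *
            (b i * (c i * Real.cos (2 * Real.pi * x * u i))))) := by
    rw [Finset.sum_sub_distrib, Finset.sum_sub_distrib, ← Finset.mul_sum, Finset.sum_sub_distrib,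
      hperp', mul_zero, sub_zero, Signal.norm_sq_eq, Signal.norm_sq_eq]
  rw [hsum]
  refine Finset.sum_nonneg fun i _ => ?_
  have hp0 : |p (i, 0) - curve c u x (i, 0)| ≤ δ :=
    (PiLp.norm_apply_le (p - curve c u x) (i, 0)).trans hp.le
  have hp1 : |p (i, 1) - curve c u x (i, 1)| ≤ δ :=
    (PiLp.norm_apply_le (p - curve c u x) (i, 1)).trans hp.le
  have ht := taylor_pair_le (hb1 i) (2 * Real.pi * x * u i) _ _ δ hp0 hp1
  have hcos := Real.cos_le_one_sub_mul_cos_sq ((hb1 i).trans (by linarith [Real.pi_gt_three]))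
  have hpi : 1 / 8 ≤ 2 / Real.pi ^ 2 := by
    rw [div_le_div_iff₀ (by norm_num) (by positivity)]
    nlinarith [Real.pi_lt_four, Real.pi_pos]
  have hcos' : Real.cos (b i) ≤ 1 - 1 / 8 * b i ^ 2 := by
    nlinarith [sq_nonneg (b i)]
  simp only [PiLp.sub_apply]
  rw [curve_zero hc0, curve_one hc0] at ht ⊢
  rw [curve_zero hc0, curve_one hc0, ecos, esin]
  have hci : 40 * δ ≤ c i := hδa.trans (hc i)
  have hgap : 0 ≤ c i * b i ^ 2 * (c i / 4 - 8 * δ) :=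
    mul_nonneg (mul_nonneg (hc0 i).le (sq_nonneg _)) (by linarith)
  have hT := mul_le_mul_of_nonneg_left ht (mul_nonneg zero_le_two (hc0 i).le)
  have hC := mul_le_mul_of_nonneg_left hcos' (mul_nonneg zero_le_two (sq_nonneg (c i)))
  have e : Real.cos (b i) =
      Real.cos (2 * Real.pi * x * u i + b i) * Real.cos (2 * Real.pi * x * u i) +
      Real.sin (2 * Real.pi * x * u i + b i) * Real.sin (2 * Real.pi * x * u i) := by
    rw [← Real.cos_sub, add_sub_cancel_left]
  rw [e] at hC
  have s1 := Real.sin_sq_add_cos_sq (2 * Real.pi * x * u i)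
  have s2 := Real.sin_sq_add_cos_sq (2 * Real.pi * x * u i + b i)
  linear_combination hT + hC + hgap - c i ^ 2 * (s1 + s2)

/-! ### Radii of the coordinate pairs -/

lemma radii_apply (y : Signal N) (i : Fin N) :
    Layers.radii y i = Real.sqrt (y (i, 0) ^ 2 + y (i, 1) ^ 2) := rfl

lemma norm_radii_sub_le (y y' : Signal N) : ‖Layers.radii y - Layers.radii y'‖ ≤ ‖y - y'‖ := by
  refine le_of_sq_le_sq ?_ (norm_nonneg _)
  rw [EuclideanSpace.real_norm_sq_eq, Signal.norm_sq_eq]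
  refine Finset.sum_le_sum fun i _ => ?_
  simp only [PiLp.sub_apply, radii_apply]
  have h1 := Real.sq_sqrt (by positivity : 0 ≤ y (i, 0) ^ 2 + y (i, 1) ^ 2)
  have h2 := Real.sq_sqrt (by positivity : 0 ≤ y' (i, 0) ^ 2 + y' (i, 1) ^ 2)
  have h3 : y (i, 0) * y' (i, 0) + y (i, 1) * y' (i, 1) ≤
      Real.sqrt (y (i, 0) ^ 2 + y (i, 1) ^ 2) * Real.sqrt (y' (i, 0) ^ 2 + y' (i, 1) ^ 2) := by
    rw [← Real.sqrt_mul (by positivity)]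
    refine Real.le_sqrt_of_sq_le ?_
    nlinarith [sq_nonneg (y (i, 0) * y' (i, 1) - y (i, 1) * y' (i, 0))]
  nlinarith

lemma radii_flatTorusMap {c : EuclideanSpace ℝ (Fin N)} (hc : ∀ i, 0 < c i)
    (v : EuclideanSpace ℝ (Fin N)) : Layers.radii (flatTorusMap c v) = c := by
  ext i
  rw [radii_apply, flatTorusMap_zero, flatTorusMap_one, mul_pow, mul_pow, ← mul_add,
    Real.cos_sq_add_sin_sq, mul_one, Real.sqrt_sq (hc i).le]

lemma norm_sub_flatTorusMap_of_polar {c γ θ : EuclideanSpace ℝ (Fin N)} {y : Signal N}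
    (h : ∀ i, y (i, 0) = γ i * Real.cos (θ i / c i) ∧ y (i, 1) = γ i * Real.sin (θ i / c i)) :
    ‖y - flatTorusMap c θ‖ = ‖γ - c‖ := by
  refine (sq_eq_sq₀ (norm_nonneg _) (norm_nonneg _)).mp ?_
  rw [Signal.norm_sq_eq, EuclideanSpace.real_norm_sq_eq]
  refine Finset.sum_congr rfl fun i _ => ?_
  simp only [PiLp.sub_apply, flatTorusMap_zero, flatTorusMap_one, (h i).1, (h i).2]
  linear_combination (γ i - c i) ^ 2 * Real.sin_sq_add_cos_sq (θ i / c i)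

/-! ### Schemes of optimal total length -/

/-- The lattice point `(1, 1 + j_1 / K, …, 1 + j_n / K)` of the affine hyperplane `w_0 = 1`. -/
noncomputable def gridPoint {n K : ℕ} (j : Fin n → Fin K) : EuclideanSpace ℝ (Fin (n + 1)) :=
  WithLp.toLp 2 (Fin.cons 1 fun i => 1 + ((j i : ℕ) : ℝ) / K)

/-- The spherical code: the central projections of the grid points to the unit sphere. -/
noncomputable def gridWord {n K : ℕ} (j : Fin n → Fin K) : EuclideanSpace ℝ (Fin (n + 1)) :=
  ‖gridPoint j‖⁻¹ • gridPoint j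

section

variable {n K : ℕ} (j : Fin n → Fin K)

lemma one_le_gridPoint (i : Fin (n + 1)) : 1 ≤ gridPoint j i := by
  refine Fin.cases ?_ (fun i => ?_) i
  · simp [gridPoint]
  · simp only [gridPoint, Fin.cons_succ, le_add_iff_nonneg_right]
    positivity

lemma gridPoint_le_two (i : Fin (n + 1)) : gridPoint j i ≤ 2 := by
  refine Fin.cases ?_ (fun i => ?_) i
  · simp [gridPoint]
  · simp only [gridPoint, Fin.cons_succ]
    have h : ((j i : ℕ) : ℝ) / K ≤ 1 :=
      div_le_one_of_le₀ (by exact_mod_cast (j i).2.le) (by positivity)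
    linarith

lemma norm_gridPoint_pos : 0 < ‖gridPoint j‖ := by
  have h := PiLp.norm_apply_le (gridPoint j) 0
  have h1 := one_le_gridPoint j 0
  have h2 := Real.le_norm_self (gridPoint j 0)
  linarith

lemma norm_gridPoint_le : ‖gridPoint j‖ ≤ 2 * Real.sqrt (n + 1) := by
  refine le_of_sq_le_sq ?_ (by positivity)
  rw [EuclideanSpace.real_norm_sq_eq, mul_pow, Real.sq_sqrt (by positivity)]
  calc ∑ i, gridPoint j i ^ 2 ≤ ∑ _i : Fin (n + 1), (2 : ℝ) ^ 2 := by
        refine Finset.sum_le_sum fun i _ => ?_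
        have h1 := one_le_gridPoint j i
        have h2 := gridPoint_le_two j i
        gcongr
    _ = 2 ^ 2 * (n + 1) := by
        simp
        ring

lemma norm_gridWord : ‖gridWord j‖ = 1 := by
  have h := norm_gridPoint_pos j
  rw [gridWord, norm_smul, norm_inv, norm_norm, inv_mul_cancel₀ h.ne']

lemma le_gridWord (i : Fin (n + 1)) : (2 * Real.sqrt (n + 1))⁻¹ ≤ gridWord j i := by
  have h := norm_gridPoint_pos j
  have h1 := one_le_gridPoint j i
  calc (2 * Real.sqrt (n + 1))⁻¹ ≤ ‖gridPoint j‖⁻¹ * 1 := by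
        rw [mul_one]
        exact inv_anti₀ h (norm_gridPoint_le j)
    _ ≤ ‖gridPoint j‖⁻¹ * gridPoint j i := by gcongr

lemma gridWord_succ (i : Fin n) :
    gridWord j i.succ = (1 + ((j i : ℕ) : ℝ) / K) * gridWord j 0 := by
  simp [gridWord, gridPoint, mul_comm]

/-- Distinct words are separated, since the central projection back to the hyperplane `w_0 = 1` is
Lipschitz on the part of the sphere where all coordinates are at least `a`. -/
lemma le_dist_gridWord {a : ℝ} (ha : 0 < a) (hK : 0 < K) {j j' : Fin n → Fin K}
    (h : ∀ i, a ≤ gridWord j i) (hj : j ≠ j') :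
    a / (3 * K) ≤ dist (gridWord j) (gridWord j') := by
  obtain ⟨i, hi⟩ := Function.ne_iff.mp hj
  have hK' : (0 : ℝ) < K := by exact_mod_cast hK
  have hij : 1 ≤ |((j i : ℕ) : ℝ) - ((j' i : ℕ) : ℝ)| := by
    have h1 : (1 : ℤ) ≤ |((j i : ℕ) : ℤ) - ((j' i : ℕ) : ℤ)| := by
      refine Int.one_le_abs ?_
      rw [sub_ne_zero]
      exact_mod_cast fun h => hi (Fin.ext h)
    exact_mod_cast h1
  rw [dist_eq_norm]
  have e0 := PiLp.norm_apply_le (gridWord j - gridWord j') 0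
  have e1 := PiLp.norm_apply_le (gridWord j - gridWord j') i.succ
  rw [Real.norm_eq_abs, PiLp.sub_apply] at e0 e1
  set D := ‖gridWord j - gridWord j'‖
  rw [gridWord_succ, gridWord_succ] at e1
  set x := ((j i : ℕ) : ℝ) / K with hx
  set x' := ((j' i : ℕ) : ℝ) / K with hx'
  have hx1 : x' ≤ 1 := div_le_one_of_le₀ (by exact_mod_cast (j' i).2.le) hK'.le
  have hx0 : 0 ≤ x' := by positivity
  have hxx : |x - x'| = |((j i : ℕ) : ℝ) - ((j' i : ℕ) : ℝ)| / K := by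
    rw [hx, hx', ← sub_div, abs_div, abs_of_pos hK']
  have e2 : (x - x') * gridWord j 0 = ((1 + x) * gridWord j 0 - (1 + x') * gridWord j' 0) -
      (1 + x') * (gridWord j 0 - gridWord j' 0) := by ring
  have e3 : |x - x'| * gridWord j 0 ≤ D + 2 * D := by
    rw [← abs_of_pos (ha.trans_le (h 0)), ← abs_mul, e2]
    refine (norm_sub_le (E := ℝ) _ _).trans (add_le_add e1 ?_)
    rw [Real.norm_eq_abs, abs_mul, abs_of_pos (by linarith : 0 < 1 + x')]
    gcongr
    linarith
  have e4 : 1 / K * a ≤ |x - x'| * gridWord j 0 := by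
    rw [hxx]
    gcongr
    exact h 0
  have e5 : a / (3 * K) = 1 / K * a / 3 := by field_simp
  linarith

end

/-- The shape of the schemes that achieve the bound: all words have coordinates at least `a`, and
all curves have the direction `(1, m, …, m^n)`, with `m` small enough against `1 / δ` for the lines
through the lattice in that direction to be at distance at least `δ`. -/
structure Layers.IsGeometric {n : ℕ} (S : Layers (n + 1)) (a : ℝ) (m : ℕ) : Prop where
  a_pos : 0 < a
  one_le_m : 1 ≤ m
  le_c : ∀ k i, a ≤ S.c k i
  u_eq : ∀ k, S.u k = fun i : Fin (n + 1) => (m : ℤ) ^ (i : ℕ)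
  mul_le : 2 * m * S.δ ≤ a

lemma Layers.IsGeometric.le_len {n : ℕ} {S : Layers (n + 1)} {a : ℝ} {m : ℕ}
    (hS : S.IsGeometric a m) (k : Fin S.M) : a * m ^ n ≤ S.len k := by
  rw [Layers.len, curveLength_curve (S.c_pos k)]
  have h := PiLp.norm_apply_le (hat (S.c k) (S.u k)) (Fin.last n)
  rw [hat_apply, hS.u_eq, Real.norm_eq_abs, abs_mul, abs_of_pos (S.c_pos k _)] at h
  rw [hS.u_eq]
  have h1 : |(((m : ℤ) ^ (Fin.last n : ℕ) : ℤ) : ℝ)| = (m : ℝ) ^ n := by simp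
  rw [h1] at h
  have h2 := hS.le_c k (Fin.last n)
  have h3 : a * (m : ℝ) ^ n ≤ S.c k (Fin.last n) * (m : ℝ) ^ n := by gcongr
  have hpi := Real.pi_gt_three
  have h4 := norm_nonneg (hat (S.c k) fun i => (m : ℤ) ^ (i : ℕ))
  nlinarith

/-- There are schemes of small-ball radius `δ` whose total length is of the optimal order
`δ^(-2n)`, namely `δ^(-n)` curves of length of the order of `δ^(-n)`. -/
lemma exists_layers (n : ℕ) : ∃ a > 0, ∃ δ₀ > 0, ∃ κ > 0, ∀ δ : ℝ, 0 < δ → δ ≤ δ₀ →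
    ∃ S : Layers (n + 1), S.δ = δ ∧ (∃ m, S.IsGeometric a m) ∧
      κ ≤ S.totalLen * δ ^ (2 * n) := by
  set a : ℝ := (2 * Real.sqrt (n + 1))⁻¹ with ha
  have ha0 : 0 < a := by positivity
  refine ⟨a, ha0, a / 40, by positivity, (a / 12) ^ n * (a * (a / 80) ^ n), by positivity, ?_⟩
  intro δ hδ0 hδ
  have half : ∀ t : ℝ, 1 ≤ t → 1 ≤ ⌊t⌋₊ ∧ t / 2 ≤ ⌊t⌋₊ := by
    intro t ht
    have h1 : 1 ≤ ⌊t⌋₊ := Nat.one_le_floor_iff t |>.mpr ht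
    have h2 := Nat.lt_floor_add_one t
    have h3 : (1 : ℝ) ≤ ⌊t⌋₊ := by exact_mod_cast h1
    exact ⟨h1, by linarith⟩
  obtain ⟨hm1, hm2⟩ := half (a / (40 * δ)) (by rw [le_div_iff₀ (by positivity)]; linarith)
  obtain ⟨hK1, hK2⟩ := half (a / (6 * δ)) (by rw [le_div_iff₀ (by positivity)]; linarith)
  have hm3 := Nat.floor_le (by positivity : 0 ≤ a / (40 * δ))
  have hK3 := Nat.floor_le (by positivity : 0 ≤ a / (6 * δ))
  set m := ⌊a / (40 * δ)⌋₊
  set K := ⌊a / (6 * δ)⌋₊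
  have hm1' : (1 : ℝ) ≤ m := by exact_mod_cast hm1
  have hK1' : (1 : ℝ) ≤ K := by exact_mod_cast hK1
  rw [le_div_iff₀ (by positivity)] at hm3 hK3
  have hmδ : 40 * m * δ ≤ a := by linarith
  have : NeZero K := ⟨by omega⟩
  set e := (Fintype.equivFin (Fin n → Fin K)).symm
  let S : Layers (n + 1) :=
    { δ := δ
      δ_pos := hδ0
      M := Fintype.card (Fin n → Fin K)
      M_pos := Fintype.card_pos
      c := fun k => gridWord (e k)
      c_pos := fun k i => ha0.trans_le (le_gridWord _ i)
      c_norm := fun k => norm_gridWord _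
      c_sep := fun k k' h => by
        refine le_trans ?_ (le_dist_gridWord ha0 hK1 (le_gridWord _)
          (e.injective.ne h))
        rw [le_div_iff₀ (by positivity)]
        linarith
      u := fun _ i => (m : ℤ) ^ (i : ℕ)
      u_primitive := fun k => by
        have h : Finset.univ.gcd (fun i : Fin (n + 1) => (m : ℤ) ^ (i : ℕ)) ∣ 1 := by
          simpa using Finset.gcd_dvd (f := fun i : Fin (n + 1) => (m : ℤ) ^ (i : ℕ))
            (Finset.mem_univ 0)
        rw [← Finset.normalize_gcd]
        exact normalize_eq_one.mpr (isUnit_of_dvd_one h)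
      curve_smallBall := fun k =>
        smallBallRadiusAtLeast_curve ha0 (le_gridWord _) hm1 hδ0 hmδ }
  have hS : S.IsGeometric a m :=
    ⟨ha0, hm1, fun k i => le_gridWord _ i, fun k => rfl, by
      show 2 * m * δ ≤ a
      nlinarith⟩
  refine ⟨S, rfl, ⟨m, hS⟩, ?_⟩
  have hlen : (K : ℝ) ^ n * (a * m ^ n) ≤ S.totalLen := by
    have h := Finset.card_nsmul_le_sum Finset.univ S.len (a * m ^ n) fun k _ => hS.le_len k
    have hM : (S.M : ℝ) = (K : ℝ) ^ n := by simp [S]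
    rwa [nsmul_eq_mul, Finset.card_univ, Fintype.card_fin, hM] at h
  have hmδ' : a / 80 ≤ m * δ := by
    have : a / 80 = a / (40 * δ) / 2 * δ := by field_simp; norm_num
    rw [this]
    gcongr
  have hKδ' : a / 12 ≤ K * δ := by
    have : a / 12 = a / (6 * δ) / 2 * δ := by field_simp; norm_num
    rw [this]
    gcongr
  calc (a / 12) ^ n * (a * (a / 80) ^ n) ≤ (K * δ) ^ n * (a * (m * δ) ^ n) := by gcongr
    _ = (K : ℝ) ^ n * (a * m ^ n) * δ ^ (2 * n) := by ring
    _ ≤ S.totalLen * δ ^ (2 * n) := by gcongr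

namespace Layers

/-! ### The partition of the source interval -/

section partition

variable {S : Layers N}

lemma totalLen_pos (h : ∀ k, 0 < S.len k) : 0 < S.totalLen :=
  Finset.sum_pos (fun k _ => h k) ⟨⟨0, S.M_pos⟩, Finset.mem_univ _⟩

lemma left_nonneg (h : ∀ k, 0 < S.len k) (k : Fin S.M) : 0 ≤ S.left k :=
  div_nonneg (Finset.sum_nonneg fun j _ => (h j).le) (totalLen_pos h).le

lemma left_add_eq (k : Fin S.M) :
    S.left k + S.len k / S.totalLen = (∑ j ∈ Finset.Iic k, S.len j) / S.totalLen := by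
  rw [left, ← add_div, ← Finset.Iio_insert, Finset.sum_insert (by simp), add_comm]

lemma left_add_le_one (h : ∀ k, 0 < S.len k) (k : Fin S.M) :
    S.left k + S.len k / S.totalLen ≤ 1 := by
  rw [left_add_eq, div_le_one (totalLen_pos h)]
  exact Finset.sum_le_sum_of_subset_of_nonneg (Finset.subset_univ _) fun j _ _ => (h j).le

lemma left_add_le_left (h : ∀ k, 0 < S.len k) {j k : Fin S.M} (hjk : j < k) :
    S.left j + S.len j / S.totalLen ≤ S.left k := by
  rw [left_add_eq, left]
  refine div_le_div_of_nonneg_right ?_ (totalLen_pos h).le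
  refine Finset.sum_le_sum_of_subset_of_nonneg (fun i hi => ?_) fun j _ _ => (h j).le
  rw [Finset.mem_Iic] at hi
  exact Finset.mem_Iio.mpr (hi.trans_lt hjk)

lemma value_mem_Icc (h : ∀ k, 0 < S.len k) (k : Fin S.M) {t : ℝ} (ht : t ∈ Set.Icc (0 : ℝ) 1) :
    S.value k t ∈ Set.Icc (0 : ℝ) 1 := by
  have h1 := left_nonneg h k
  have h2 := left_add_le_one h k
  have h3 := div_pos (h k) (totalLen_pos h)
  refine ⟨add_nonneg h1 (mul_nonneg ht.1 h3.le), le_trans ?_ h2⟩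
  rw [value]
  nlinarith [ht.2]

lemma value_coord (h : ∀ k, 0 < S.len k) (k : Fin S.M) (x : ℝ) :
    S.value k (S.coord k x) = x := by
  have h3 := div_pos (h k) (totalLen_pos h)
  rw [value, coord, div_mul_cancel₀ _ h3.ne', add_sub_cancel]

lemma coord_mem_Icc (h : ∀ k, 0 < S.len k) {k : Fin S.M} {x : ℝ} (hx : x ∈ S.interval k) :
    S.coord k x ∈ Set.Icc (0 : ℝ) 1 := by
  have h3 := div_pos (h k) (totalLen_pos h)
  refine ⟨div_nonneg (sub_nonneg.mpr hx.1) h3.le, ?_⟩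
  rw [coord, div_le_one h3]
  linarith [hx.2]

lemma encode_of_mem_interval (h : ∀ k, 0 < S.len k) (α P : ℝ) {k : Fin S.M} {x : ℝ}
    (hx : x ∈ S.interval k) : S.encode α P x = S.point α P k (S.coord k x) := by
  rw [encode, Finset.sum_eq_single k]
  · rw [Set.indicator_of_mem hx]
  · intro j _ hj
    refine Set.indicator_of_notMem (fun hxj => ?_) _
    rcases lt_or_gt_of_ne hj with hlt | hlt
    · linarith [left_add_le_left h hlt, hx.1, hxj.2]
    · linarith [left_add_le_left h hlt, hxj.1, hx.2]
  · simp

lemma exists_mem_interval (h : ∀ k, 0 < S.len k) {x : ℝ} (hx : x ∈ Set.Ico (0 : ℝ) 1) :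
    ∃ k, x ∈ S.interval k := by
  have hL := totalLen_pos h
  -- the last interval whose left endpoint is at most `x`
  obtain ⟨k, hk, hmax⟩ := Finset.exists_max_image (Finset.univ.filter fun k => S.left k ≤ x) id
    ⟨⟨0, S.M_pos⟩, by
      have : Finset.Iio (⟨0, S.M_pos⟩ : Fin S.M) = ∅ := by
        ext i
        simp [Fin.lt_def]
      rw [Finset.mem_filter, left, this, Finset.sum_empty, zero_div]
      exact ⟨Finset.mem_univ _, hx.1⟩⟩
  rw [Finset.mem_filter] at hk
  refine ⟨k, hk.2, ?_⟩
  by_contra! hxk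
  rw [left_add_eq] at hxk
  by_cases hlast : (k : ℕ) + 1 < S.M
  · have hI : Finset.Iio (⟨k + 1, hlast⟩ : Fin S.M) = Finset.Iic k := by
      ext i
      rw [Finset.mem_Iio, Finset.mem_Iic, Fin.lt_def, Fin.le_def]
      exact Nat.lt_succ_iff
    have hle := hmax ⟨k + 1, hlast⟩ (by
      rw [Finset.mem_filter, left, hI]
      exact ⟨Finset.mem_univ _, hxk⟩)
    simp [Fin.le_def] at hle
  · have hI : Finset.Iic k = Finset.univ := by
      ext i
      simp only [Finset.mem_Iic, Fin.le_def, Finset.mem_univ, iff_true]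
      omega
    rw [hI, ← totalLen, div_self hL.ne'] at hxk
    linarith [hx.2]

end partition

namespace IsGeometric

/-! ### Decoding -/

variable {n : ℕ} {S : Layers (n + 1)} {a : ℝ} {m : ℕ}

lemma len_pos (hS : S.IsGeometric a m) (k : Fin S.M) : 0 < S.len k := by
  have h1 : (0 : ℝ) < m := by exact_mod_cast hS.one_le_m
  have h2 := hS.a_pos
  exact (by positivity : 0 < a * (m : ℝ) ^ n).trans_le (hS.le_len k)

lemma le_norm_hat (hS : S.IsGeometric a m) (k : Fin S.M) : a ≤ ‖hat (S.c k) (S.u k)‖ := by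
  refine le_trans ?_ (PiLp.norm_apply_le (hat (S.c k) (S.u k)) 0)
  rw [hat_apply, hS.u_eq]
  simpa using (hS.le_c k 0).trans (le_abs_self _)

/-- If two parameters of an opened curve are close up to a period, then the period is zero: this is
where the factor `α < 1` is used. -/
lemma abs_value_sub_value_le (hS : S.IsGeometric a m) {α : ℝ} (hα0 : 0 < α)
    (hδ : S.δ ≤ a * (1 - α)) {k : Fin S.M} {t t' : ℝ} (ht : t ∈ Set.Icc (0 : ℝ) 1)
    (ht' : t' ∈ Set.Icc (0 : ℝ) 1) {r : ℝ} (hr : r < S.δ) {q : ℤ}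
    (hq : ‖hat (S.c k) (S.u k)‖ * |α * t - α * t' - q| ≤ r) :
    |S.value k t - S.value k t'| ≤ 2 * Real.pi * r / (α * S.totalLen) := by
  have ha := hS.a_pos
  have hL := totalLen_pos hS.len_pos
  have htt : |α * t - α * t'| ≤ α := by
    rw [← mul_sub, abs_mul, abs_of_pos hα0]
    have : |t - t'| ≤ 1 := abs_sub_le_iff.mpr ⟨by linarith [ht.2, ht'.1], by linarith [ht.1, ht'.2]⟩
    nlinarith
  have hq0 : q = 0 := by
    by_contra hne
    have h1 : (1 : ℝ) ≤ |(q : ℝ)| := by exact_mod_cast Int.one_le_abs hne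
    have h2 : |(q : ℝ)| ≤ |α * t - α * t'| + |α * t - α * t' - q| := by
      have := norm_sub_le (E := ℝ) (α * t - α * t') (α * t - α * t' - q)
      rwa [sub_sub_cancel] at this
    have h3 : a * |α * t - α * t' - q| ≤ r :=
      (mul_le_mul_of_nonneg_right (hS.le_norm_hat k) (abs_nonneg _)).trans hq
    nlinarith
  rw [hq0, Int.cast_zero, sub_zero, ← mul_sub, abs_mul, abs_of_pos hα0] at hq
  have e : |S.value k t - S.value k t'| =
      2 * Real.pi * (‖hat (S.c k) (S.u k)‖ * (α * |t - t'|)) / (α * S.totalLen) := by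
    rw [value, value, len, curveLength_curve (S.c_pos k), add_sub_add_left_eq_sub, ← sub_mul,
      abs_mul, abs_of_nonneg (by positivity :
        0 ≤ 2 * Real.pi * ‖hat (S.c k) (S.u k)‖ / S.totalLen)]
    field_simp
  rw [e]
  gcongr

/-- Maximum likelihood decoding: the decoded point is within `2 ‖w‖` of the transmitted one, hence
on the same torus, as distinct tori are at distance at least `2 δ`; and it is close in parameter. -/
lemma abs_sub_le_of_isMLDecoder (hS : S.IsGeometric a m) {α P : ℝ} (hα0 : 0 < α) (hP : 0 < P)
    (hδ : S.δ ≤ a * (1 - α)) {xhat : Signal (n + 1) → ℝ} (hx : S.IsMLDecoder α P xhat)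
    {k : Fin S.M} {t : ℝ} (ht : t ∈ Set.Icc (0 : ℝ) 1) {w : Signal (n + 1)} (hw : ‖w‖ < S.δ) :
    |S.value k t - xhat (S.point α P k t + Real.sqrt P • w)| ≤
      2 * Real.pi * ‖w‖ / (α * S.totalLen) := by
  obtain ⟨j, t', ht', hval, hmin⟩ := hx (S.point α P k t + Real.sqrt P • w)
  have hsP := Real.sqrt_pos.mpr hP
  have h1 := hmin k t ht
  rw [add_sub_cancel_left, point, point, ← smul_add, ← smul_sub, norm_smul, norm_smul] at h1
  have h2 := le_of_mul_le_mul_left h1 (norm_pos_iff.mpr hsP.ne')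
  have h3 : ‖curve (S.c k) (S.u k) (α * t) - curve (S.c j) (S.u j) (α * t')‖ ≤ 2 * ‖w‖ := by
    have := norm_sub_le (curve (S.c k) (S.u k) (α * t) + w - curve (S.c j) (S.u j) (α * t')) w
    rw [add_sub_right_comm, add_sub_cancel_right] at this
    rw [add_sub_right_comm] at h2
    linarith
  obtain rfl : k = j := by
    by_contra hne
    have h4 := norm_radii_sub_le (curve (S.c k) (S.u k) (α * t)) (curve (S.c j) (S.u j) (α * t'))
    rw [curve, curve, radii_flatTorusMap (S.c_pos k), radii_flatTorusMap (S.c_pos j),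
      ← curve, ← curve, ← dist_eq_norm] at h4
    linarith [S.c_sep k j hne]
  obtain ⟨q, hq⟩ := exists_norm_mul_abs_sub_le hS.a_pos (hS.le_c k) hS.one_le_m hS.mul_le
    (x := α * t) (y := α * t') (by rw [← hS.u_eq k]; linarith)
  rw [← hS.u_eq k] at hq
  rw [hval]
  exact hS.abs_value_sub_value_le hα0 hδ ht ht' hw (hq.trans (by linarith [norm_nonneg w]))

/-- Torus decoding: the radii of the received vector are within `‖w‖` of the word of the transmitted
layer, which is therefore recovered; its angles are within the order of `‖w‖` of a lift of the
transmitted point, and lifts of the other parts of the curve are farther apart. -/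
lemma abs_sub_le_of_isTorusDecoder (hS : S.IsGeometric a m) {α P : ℝ} (hα0 : 0 < α) (hP : 0 < P)
    (hδ : S.δ ≤ a * (1 - α)) {xhat : Signal (n + 1) → ℝ} (hx : S.IsTorusDecoder α P xhat)
    {k : Fin S.M} {t : ℝ} (ht : t ∈ Set.Icc (0 : ℝ) 1) {w : Signal (n + 1)} (hw : ‖w‖ < S.δ) :
    |S.value k t - xhat (S.point α P k t + Real.sqrt P • w)| ≤
      2 * Real.pi * ‖w‖ / (α * S.totalLen) := by
  have hpi := Real.pi_pos
  have hsP := Real.sqrt_pos.mpr hP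
  obtain ⟨j, t', ht', hval, hclose, θ, hθ, k₁, hmin⟩ := hx (S.point α P k t + Real.sqrt P • w)
  have hy : (Real.sqrt P)⁻¹ • (S.point α P k t + Real.sqrt P • w) =
      curve (S.c k) (S.u k) (α * t) + w := by
    rw [point, ← smul_add, inv_smul_smul₀ hsP.ne']
  rw [hy] at hclose hθ
  set y := curve (S.c k) (S.u k) (α * t) + w with hydef
  have hyw : y - curve (S.c k) (S.u k) (α * t) = w := add_sub_cancel_left _ _
  have hγ : ‖radii y - S.c k‖ ≤ ‖w‖ := by
    have := norm_radii_sub_le y (curve (S.c k) (S.u k) (α * t))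
    rwa [hyw, curve, radii_flatTorusMap (S.c_pos k)] at this
  obtain rfl : k = j := by
    by_contra hne
    have h1 := hclose k
    have h2 := dist_triangle_left (S.c k) (S.c j) (radii y)
    rw [dist_eq_norm (radii y) (S.c k)] at h1 h2
    linarith [S.c_sep k j hne]
  set v := hat (S.c k) (S.u k) with hv
  have h1 : ‖flatTorusMap (S.c k) θ - curve (S.c k) (S.u k) (α * t)‖ ≤ 2 * ‖w‖ := by
    have h2 := norm_sub_flatTorusMap_of_polar hθ
    have h3 := norm_sub_le_norm_sub_add_norm_sub (flatTorusMap (S.c k) θ) y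
      (curve (S.c k) (S.u k) (α * t))
    rw [norm_sub_rev _ y, h2, hyw] at h3
    linarith
  obtain ⟨k₀, hk₀⟩ := exists_norm_sub_hat_le (S.c_pos k) θ ((2 * Real.pi * (α * t)) • v)
  rw [hv, ← curve, ← hv] at hk₀
  have h2 := hmin t ht k₀
  have e0 : θ - (2 * Real.pi * (α * t)) • v - (2 * Real.pi) • hat (S.c k) k₀ =
      θ - (2 * Real.pi) • ((α * t) • v + hat (S.c k) k₀) := by module
  rw [e0] at hk₀
  have h3 : ‖θ - (2 * Real.pi) • ((α * t) • v + hat (S.c k) k₀)‖ ≤ Real.pi * ‖w‖ := by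
    refine hk₀.trans ?_
    calc _ ≤ Real.pi / 2 * (2 * ‖w‖) := by gcongr
      _ = Real.pi * ‖w‖ := by ring
  have e1 : (2 * Real.pi) • ((α * t - α * t') • v - hat (S.c k) (k₁ - k₀)) =
      (θ - (2 * Real.pi) • ((α * t') • v + hat (S.c k) k₁)) -
        (θ - (2 * Real.pi) • ((α * t) • v + hat (S.c k) k₀)) := by
    have : hat (S.c k) (k₁ - k₀) = hat (S.c k) k₁ - hat (S.c k) k₀ := by
      ext i
      simp [hat_apply, mul_sub]
    rw [this]
    module
  have h4 : ‖(α * t - α * t') • v - hat (S.c k) (k₁ - k₀)‖ ≤ ‖w‖ := by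
    refine le_of_mul_le_mul_left (a := 2 * Real.pi) ?_ (by positivity)
    rw [← Real.norm_of_nonneg (by positivity : 0 ≤ 2 * Real.pi), ← norm_smul, e1,
      Real.norm_of_nonneg (by positivity : 0 ≤ 2 * Real.pi)]
    refine (norm_sub_le _ _).trans ?_
    linarith
  rw [hval]
  have hu := hS.u_eq k
  obtain ⟨q, hq⟩ := exists_eq_mul_of_norm_lt hS.a_pos (hS.le_c k) hS.one_le_m hS.mul_le
    (by rw [← hu]; exact h4.trans_lt hw)
  have e2 : hat (S.c k) (k₁ - k₀) = (q : ℝ) • v := by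
    ext i
    rw [hv, PiLp.smul_apply, hat_apply, hat_apply, hq i, hu, smul_eq_mul]
    push_cast
    ring
  rw [e2, ← sub_smul, norm_smul, Real.norm_eq_abs, mul_comm] at h4
  exact hS.abs_value_sub_value_le hα0 hδ ht ht' hw h4

/-- As long as the noise is less than `δ √P`, the error is of the order of the noise, divided by the
stretch `√P L` of the encoder. -/
lemma abs_sub_decode_le (hS : S.IsGeometric a m) {α P : ℝ} (hα0 : 0 < α) (hP : 0 < P)
    (hδ : S.δ ≤ a * (1 - α)) {xhat : Signal (n + 1) → ℝ}
    (hx : S.IsMLDecoder α P xhat ∨ S.IsTorusDecoder α P xhat) {x : ℝ}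
    (hx01 : x ∈ Set.Ico (0 : ℝ) 1) {z : Signal (n + 1)} (hz : ‖z‖ < S.δ * Real.sqrt P) :
    |x - xhat (S.encode α P x + z)| ≤
      2 * Real.pi / (α * S.totalLen) * ‖z‖ / Real.sqrt P := by
  have hsP := Real.sqrt_pos.mpr hP
  obtain ⟨k, hk⟩ := exists_mem_interval hS.len_pos hx01
  have hw : ‖(Real.sqrt P)⁻¹ • z‖ = ‖z‖ / Real.sqrt P := by
    rw [norm_smul, norm_inv, Real.norm_of_nonneg hsP.le, inv_mul_eq_div]
  have hw' : ‖(Real.sqrt P)⁻¹ • z‖ < S.δ := by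
    rwa [hw, div_lt_iff₀ hsP]
  have ht := coord_mem_Icc hS.len_pos hk
  have h : |S.value k (S.coord k x) -
      xhat (S.point α P k (S.coord k x) + Real.sqrt P • (Real.sqrt P)⁻¹ • z)| ≤
      2 * Real.pi * ‖(Real.sqrt P)⁻¹ • z‖ / (α * S.totalLen) := by
    rcases hx with hx | hx
    · exact hS.abs_sub_le_of_isMLDecoder hα0 hP hδ hx ht hw'
    · exact hS.abs_sub_le_of_isTorusDecoder hα0 hP hδ hx ht hw'
  rw [value_coord hS.len_pos, smul_inv_smul₀ hsP.ne', hw] at h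
  rw [encode_of_mem_interval hS.len_pos α P hk]
  refine h.trans_eq ?_
  ring

lemma abs_sub_decode_le_one (hS : S.IsGeometric a m) {α P : ℝ} {xhat : Signal (n + 1) → ℝ}
    (hx : S.IsMLDecoder α P xhat ∨ S.IsTorusDecoder α P xhat) {x : ℝ}
    (hx01 : x ∈ Set.Ico (0 : ℝ) 1) (y : Signal (n + 1)) : |x - xhat y| ≤ 1 := by
  have h : xhat y ∈ Set.Icc (0 : ℝ) 1 := by
    rcases hx with hx | hx
    · obtain ⟨k, t, ht, hval, _⟩ := hx y
      exact hval ▸ value_mem_Icc hS.len_pos k ht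
    · obtain ⟨k, t, ht, hval, _⟩ := hx y
      exact hval ▸ value_mem_Icc hS.len_pos k ht
  exact abs_sub_le_iff.mpr ⟨by linarith [hx01.2, h.1], by linarith [hx01.1, h.2]⟩

end IsGeometric

end Layers

/-! ### Gaussian noise and the mean squared error -/

/-- The sum of `e^(r z_p) + e^(-r z_p)` over the coordinates of `z`. With a suitable factor it
bounds both `‖z‖ ^ 2` and the indicator of the event that `‖z‖` is large. -/
noncomputable def expSum {N : ℕ} (r : ℝ) (z : Signal N) : ℝ :=
  ∑ p, (Real.exp (r * z p) + Real.exp (-r * z p))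

lemma expSum_nonneg (r : ℝ) (z : Signal N) : 0 ≤ expSum r z := by
  unfold expSum
  positivity

lemma measurable_expSum (r : ℝ) : Measurable (expSum r : Signal N → ℝ) := by
  unfold expSum
  fun_prop

lemma lintegral_exp_noise (σ r : ℝ) (p : Fin N × Fin 2) :
    ∫⁻ z, ENNReal.ofReal (Real.exp (r * z p)) ∂(noise N σ) =
      ENNReal.ofReal (Real.exp (σ ^ 2 * r ^ 2 / 2)) := by
  have hm : Measurable fun x : ℝ => ENNReal.ofReal (Real.exp (r * x)) := by fun_prop
  have hmgf := congrFun (mgf_id_gaussianReal (μ := 0) (v := (σ ^ 2).toNNReal)) r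
  rw [zero_mul, zero_add, Real.coe_toNNReal _ (sq_nonneg σ)] at hmgf
  rw [noise, lintegral_map (by fun_prop) (by fun_prop)]
  rw [(measurePreserving_eval (fun _ : Fin N × Fin 2 => gaussianReal 0 (σ ^ 2).toNNReal)
    p).lintegral_comp hm, ← hmgf, mgf]
  exact (ofReal_integral_eq_lintegral_ofReal (integrable_exp_mul_gaussianReal r)
    (Filter.Eventually.of_forall fun x => (Real.exp_pos _).le)).symm

lemma lintegral_expSum_noise (σ r : ℝ) :
    ∫⁻ z, ENNReal.ofReal (expSum r z) ∂(noise N σ) =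
      ENNReal.ofReal (4 * N * Real.exp (σ ^ 2 * r ^ 2 / 2)) := by
  have h : ∀ z : Signal N, ENNReal.ofReal (expSum r z) =
      ∑ p, (ENNReal.ofReal (Real.exp (r * z p)) + ENNReal.ofReal (Real.exp (-r * z p))) := by
    intro z
    rw [expSum, ENNReal.ofReal_sum_of_nonneg fun p _ => by positivity]
    exact Finset.sum_congr rfl fun p _ => ENNReal.ofReal_add (by positivity) (by positivity)
  simp_rw [h]
  rw [lintegral_finsetSum _ fun p _ => by fun_prop]
  have h2 : ∀ p : Fin N × Fin 2, ∫⁻ z, (ENNReal.ofReal (Real.exp (r * z p)) +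
      ENNReal.ofReal (Real.exp (-r * z p))) ∂(noise N σ) =
      ENNReal.ofReal (2 * Real.exp (σ ^ 2 * r ^ 2 / 2)) := by
    intro p
    rw [lintegral_add_left (by fun_prop), lintegral_exp_noise, lintegral_exp_noise, neg_sq,
      ← ENNReal.ofReal_add (by positivity) (by positivity), two_mul]
  simp_rw [h2]
  rw [Finset.sum_const, Finset.card_univ, ← ENNReal.ofReal_nsmul]
  congr 1
  simp
  ring

lemma sq_le_exp_add_exp_neg (x : ℝ) : x ^ 2 ≤ Real.exp x + Real.exp (-x) := by
  have h := Real.self_le_sinh_iff.mpr (abs_nonneg (x / 2))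
  rw [← Real.abs_sinh] at h
  have h2 := sq_le_sq.mpr h
  rw [Real.sinh_eq] at h2
  have e1 : Real.exp x = Real.exp (x / 2) ^ 2 := by
    rw [← Real.exp_nat_mul]; congr 1; push_cast; ring
  have e2 : Real.exp (-x) = Real.exp (-(x / 2)) ^ 2 := by
    rw [← Real.exp_nat_mul]; congr 1; push_cast; ring
  have e3 : Real.exp (x / 2) * Real.exp (-(x / 2)) = 1 := by
    rw [← Real.exp_add, add_neg_cancel, Real.exp_zero]
  rw [e1, e2]
  nlinarith

lemma norm_sq_le_expSum (z : Signal N) : ‖z‖ ^ 2 ≤ expSum 1 z := by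
  rw [EuclideanSpace.real_norm_sq_eq, expSum]
  refine Finset.sum_le_sum fun p _ => ?_
  rw [one_mul, neg_one_mul]
  exact sq_le_exp_add_exp_neg (z p)

lemma exp_le_expSum {r ℓ : ℝ} (hr : 0 ≤ r) (hℓ : 0 < ℓ) {z : Signal N} (hz : ℓ ≤ ‖z‖) :
    Real.exp (r * (ℓ / (2 * N))) ≤ expSum r z := by
  obtain ⟨p, hp⟩ : ∃ p, ℓ / (2 * N) ≤ |z p| := by
    by_contra! hlt
    have hN : 0 < N := by
      rcases Nat.eq_zero_or_pos N with rfl | h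
      · rw [Subsingleton.elim z 0, norm_zero] at hz
        linarith
      · exact h
    have hN' : (1 : ℝ) ≤ N := by exact_mod_cast hN
    have h1 : ‖z‖ ^ 2 < ℓ ^ 2 := by
      calc ‖z‖ ^ 2 = ∑ p, z p ^ 2 := EuclideanSpace.real_norm_sq_eq z
        _ < ∑ _p : Fin N × Fin 2, (ℓ / (2 * N)) ^ 2 := by
            refine Finset.sum_lt_sum_of_nonempty ⟨(⟨0, hN⟩, 0), Finset.mem_univ _⟩ fun p _ => ?_
            rw [← sq_abs (z p)]
            exact pow_lt_pow_left₀ (hlt p) (abs_nonneg _) two_ne_zero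
        _ = ℓ ^ 2 / (2 * N) := by
            simp
            field_simp
        _ ≤ ℓ ^ 2 := div_le_self (sq_nonneg ℓ) (by linarith)
    exact absurd (lt_of_pow_lt_pow_left₀ 2 hℓ.le h1) hz.not_gt
  have h1 : Real.exp (r * (ℓ / (2 * N))) ≤ Real.exp (r * z p) + Real.exp (-r * z p) := by
    have h2 : Real.exp (r * (ℓ / (2 * N))) ≤ Real.exp (r * |z p|) := by gcongr
    refine h2.trans ?_
    rcases abs_cases (z p) with ⟨h, _⟩ | ⟨h, _⟩ <;> rw [h]
    · linarith [Real.exp_pos (-r * z p)]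
    · rw [mul_neg, ← neg_mul]
      linarith [Real.exp_pos (r * z p)]
  exact h1.trans (Finset.single_le_sum
    (f := fun p => Real.exp (r * z p) + Real.exp (-r * z p)) (fun p _ => by positivity)
    (Finset.mem_univ p))

/-- The two contributions to the mean squared error: that of small noise, which is amplified by the
inverse of the stretch of the encoder, and that of the event that the noise leaves the ball of
radius `δ √P`, bounded by a Chernoff bound with parameter `r`. -/
lemma Layers.IsGeometric.mse_le {n : ℕ} {S : Layers (n + 1)} {a : ℝ} {m : ℕ}
    (hS : S.IsGeometric a m) {ν : Measure ℝ} [IsProbabilityMeasure ν]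
    (hν : ν (Set.Ico 0 1) = 1) (σ : ℝ) {α P r : ℝ} (hα0 : 0 < α) (hP : 0 < P) (hr : 0 ≤ r)
    (hδ : S.δ ≤ a * (1 - α)) {xhat : Signal (n + 1) → ℝ}
    (hx : S.IsMLDecoder α P xhat ∨ S.IsTorusDecoder α P xhat) :
    mse S ν σ α P xhat ≤ ENNReal.ofReal
      ((2 * Real.pi / (α * S.totalLen)) ^ 2 / P *
          (4 * (n + 1 : ℕ) * Real.exp (σ ^ 2 * 1 ^ 2 / 2)) +
        Real.exp (-(r * (S.δ * Real.sqrt P / (2 * (n + 1 : ℕ))))) *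
          (4 * (n + 1 : ℕ) * Real.exp (σ ^ 2 * r ^ 2 / 2))) := by
  set A := (2 * Real.pi / (α * S.totalLen)) ^ 2 / P with hA
  set T := Real.exp (-(r * (S.δ * Real.sqrt P / (2 * (n + 1 : ℕ))))) with hT
  have hA0 : 0 ≤ A := by positivity
  have hsP := Real.sqrt_pos.mpr hP
  have hae : ∀ᵐ x ∂ν, x ∈ Set.Ico (0 : ℝ) 1 :=
    (mem_ae_iff_prob_eq_one measurableSet_Ico).mpr hν
  have hpt : ∀ x ∈ Set.Ico (0 : ℝ) 1, ∀ z : Signal (n + 1),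
      (x - xhat (S.encode α P x + z)) ^ 2 ≤ A * expSum 1 z + T * expSum r z := by
    intro x hx01 z
    have hE1 := mul_nonneg hA0 (expSum_nonneg 1 z)
    have hEr := mul_nonneg (Real.exp_pos _).le (expSum_nonneg r z) (a := T)
    rw [← sq_abs]
    rcases lt_or_ge ‖z‖ (S.δ * Real.sqrt P) with hz | hz
    · have h := pow_le_pow_left₀ (abs_nonneg _)
        (hS.abs_sub_decode_le hα0 hP hδ hx hx01 hz) 2
      rw [div_pow, mul_pow, Real.sq_sqrt hP.le, mul_div_right_comm, ← hA] at h
      have h2 := mul_le_mul_of_nonneg_left (norm_sq_le_expSum z) hA0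
      linarith
    · have h := pow_le_pow_left₀ (abs_nonneg _)
        (hS.abs_sub_decode_le_one hx hx01 (S.encode α P x + z)) 2
      have h2 := mul_le_mul_of_nonneg_left
        (exp_le_expSum hr (mul_pos S.δ_pos hsP) hz) (Real.exp_pos _).le (a := T)
      rw [hT, ← Real.exp_add, neg_add_cancel, Real.exp_zero, ← hT] at h2
      linarith
  have hinner : ∀ x ∈ Set.Ico (0 : ℝ) 1,
      ∫⁻ z, ENNReal.ofReal ((x - xhat (S.encode α P x + z)) ^ 2) ∂(noise (n + 1) σ) ≤
        ENNReal.ofReal (A * (4 * (n + 1 : ℕ) * Real.exp (σ ^ 2 * 1 ^ 2 / 2)) +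
          T * (4 * (n + 1 : ℕ) * Real.exp (σ ^ 2 * r ^ 2 / 2))) := by
    intro x hx01
    refine (lintegral_mono fun z => ENNReal.ofReal_le_ofReal (hpt x hx01 z)).trans_eq ?_
    have hT0 : 0 ≤ T := (Real.exp_pos _).le
    have hsplit : ∀ z : Signal (n + 1), ENNReal.ofReal (A * expSum 1 z + T * expSum r z) =
        ENNReal.ofReal A * ENNReal.ofReal (expSum 1 z) +
          ENNReal.ofReal T * ENNReal.ofReal (expSum r z) := by
      intro z
      rw [ENNReal.ofReal_add (mul_nonneg hA0 (expSum_nonneg _ _))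
        (mul_nonneg hT0 (expSum_nonneg _ _)), ENNReal.ofReal_mul hA0, ENNReal.ofReal_mul hT0]
    have hm : ∀ r : ℝ, Measurable fun z : Signal (n + 1) => ENNReal.ofReal (expSum r z) :=
      fun r => (measurable_expSum r).ennreal_ofReal
    simp_rw [hsplit]
    rw [lintegral_add_left ((hm 1).const_mul _), lintegral_const_mul _ (hm 1),
      lintegral_const_mul _ (hm r), lintegral_expSum_noise, lintegral_expSum_noise,
      ← ENNReal.ofReal_mul hA0, ← ENNReal.ofReal_mul hT0,
      ← ENNReal.ofReal_add (by positivity) (by positivity)]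
  calc mse S ν σ α P xhat ≤ ∫⁻ _x, ENNReal.ofReal
        (A * (4 * (n + 1 : ℕ) * Real.exp (σ ^ 2 * 1 ^ 2 / 2)) +
          T * (4 * (n + 1 : ℕ) * Real.exp (σ ^ 2 * r ^ 2 / 2))) ∂ν :=
        lintegral_mono_ae (hae.mono hinner)
    _ = _ := by rw [lintegral_const, measure_univ, mul_one]

end TorusLayer

/-! ### The exponent of the mean squared error -/

theorem theorem3 (N : ℕ) (hN : 1 ≤ N) (σ : ℝ) (hσ : 0 < σ)
    (ν : MeasureTheory.Measure ℝ) [MeasureTheory.IsProbabilityMeasure ν]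
    (hν : ν (Set.Ico 0 1) = 1)
    (α : ℝ) (hα0 : 0 < α) (hα1 : α < 1) :
    ∃ S : ℝ → TorusLayer.Layers N, ∀ μ : ℝ, 0 < μ → ∃ C : ℝ,
      ∀ᶠ P : ℝ in Filter.atTop, ∀ xhat : TorusLayer.Signal N → ℝ,
        ((S P).IsMLDecoder α P xhat ∨ (S P).IsTorusDecoder α P xhat) →
          TorusLayer.mse (S P) ν σ α P xhat ≤
            ENNReal.ofReal (C * P ^ (-(2 * (N : ℝ) - 1) + μ)) := by
  obtain ⟨n, rfl⟩ : ∃ n, N = n + 1 := ⟨N - 1, by omega⟩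
  obtain ⟨a, ha, δ₀, hδ₀, κ, hκ, hex⟩ := TorusLayer.exists_layers n
  -- The radius exceeds the size of the noise by a logarithmic factor only, which makes large noise
  -- superpolynomially rare without affecting the exponent.
  set δ : ℝ → ℝ := fun P => Real.log P / Real.sqrt P with hδdef
  have hex' : ∀ P : ℝ, ∃ S : TorusLayer.Layers (n + 1), 0 < δ P → δ P ≤ δ₀ →
      S.δ = δ P ∧ (∃ m, S.IsGeometric a m) ∧ κ ≤ S.totalLen * δ P ^ (2 * n) := by
    intro P
    by_cases h : 0 < δ P ∧ δ P ≤ δ₀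
    · obtain ⟨S, hS⟩ := hex (δ P) h.1 h.2
      exact ⟨S, fun _ _ => hS⟩
    · obtain ⟨S, -⟩ := hex δ₀ hδ₀ le_rfl
      exact ⟨S, fun h1 h2 => absurd ⟨h1, h2⟩ h⟩
  choose S hS using hex'
  refine ⟨S, fun μ hμ => ?_⟩
  -- The Chernoff parameter for which the tail bound is `P ^ (-(2 n + 1))`.
  set r : ℝ := (2 * (n + 1 : ℕ)) * (2 * n + 1) with hr
  set K : ℝ → ℝ := fun r => 4 * (n + 1 : ℕ) * Real.exp (σ ^ 2 * r ^ 2 / 2) with hK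
  refine ⟨(2 * Real.pi / (α * κ)) ^ 2 * K 1 + K r, ?_⟩
  have hlim : Filter.Tendsto δ Filter.atTop (nhds 0) := by
    have h := (isLittleO_log_rpow_atTop (r := 1 / 2) (by norm_num)).tendsto_div_nhds_zero
    simpa only [hδdef, Real.sqrt_eq_rpow] using h
  have hlog : ∀ᶠ P : ℝ in Filter.atTop, Real.log P ^ (4 * n) ≤ P ^ μ := by
    have h := isLittleO_log_rpow_rpow_atTop (4 * n : ℕ) hμ
    filter_upwards [h.bound zero_lt_one, Filter.eventually_ge_atTop 1] with P hP h1
    rw [Real.rpow_natCast, one_mul, Real.norm_of_nonneg (pow_nonneg (Real.log_nonneg h1) _),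
      Real.norm_of_nonneg (Real.rpow_nonneg (by linarith) _)] at hP
    exact hP
  filter_upwards [hlog, Filter.eventually_gt_atTop 1, hlim.eventually_le_const hδ₀,
    hlim.eventually_le_const (mul_pos ha (sub_pos.mpr hα1))] with P hPlog hP1 hPδ₀ hPα xhat hxhat
  have hP : 0 < P := by linarith
  have hsP := Real.sqrt_pos.mpr hP
  have hlogP := Real.log_pos hP1
  obtain ⟨hSδ, ⟨m, hgeom⟩, hlen⟩ := hS P (div_pos hlogP hsP) hPδ₀
  refine (hgeom.mse_le hν σ hα0 hP (r := r) (by positivity) (hSδ ▸ hPα) hxhat).trans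
    (ENNReal.ofReal_le_ofReal ?_)
  have hL := TorusLayer.Layers.totalLen_pos hgeom.len_pos
  set L := (S P).totalLen
  have hpow : P ^ (-(2 * ((n + 1 : ℕ) : ℝ) - 1) + μ) = P ^ μ / P ^ (2 * n + 1) := by
    rw [← Real.rpow_natCast, ← Real.rpow_sub hP]
    congr 1
    push_cast
    ring
  have htail : Real.exp (-(r * ((S P).δ * Real.sqrt P / (2 * (n + 1 : ℕ))))) =
      1 / P ^ (2 * n + 1) := by
    have h1 : r * ((S P).δ * Real.sqrt P / (2 * (n + 1 : ℕ))) =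
        ((2 * n + 1 : ℕ) : ℝ) * Real.log P := by
      rw [hSδ, hδdef, hr]
      push_cast
      field_simp
    rw [h1, Real.exp_neg, Real.exp_nat_mul, Real.exp_log hP, one_div]
  have hmain : (2 * Real.pi / (α * L)) ^ 2 / P ≤
      (2 * Real.pi / (α * κ)) ^ 2 * (P ^ μ / P ^ (2 * n + 1)) := by
    have h1 : 2 * Real.pi / (α * L) ≤ 2 * Real.pi / (α * κ) * δ P ^ (2 * n) := by
      rw [div_mul_eq_mul_div, div_le_div_iff₀ (by positivity) (by positivity)]
      calc 2 * Real.pi * (α * κ) ≤ 2 * Real.pi * (α * (L * δ P ^ (2 * n))) := by gcongr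
        _ = _ := by ring
    have h2 : (δ P ^ (2 * n)) ^ 2 = Real.log P ^ (4 * n) / P ^ (2 * n) := by
      rw [hδdef, ← pow_mul, div_pow, show 2 * n * 2 = 2 * (2 * n) by ring, pow_mul (Real.sqrt P),
        Real.sq_sqrt hP.le, show 2 * (2 * n) = 4 * n by ring]
    calc (2 * Real.pi / (α * L)) ^ 2 / P
        ≤ (2 * Real.pi / (α * κ) * δ P ^ (2 * n)) ^ 2 / P := by gcongr
      _ = (2 * Real.pi / (α * κ)) ^ 2 * (Real.log P ^ (4 * n) / P ^ (2 * n + 1)) := by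
          rw [mul_pow, h2, pow_succ P]
          field_simp
      _ ≤ _ := by gcongr
  have hPμ : 1 ≤ P ^ μ := Real.one_le_rpow hP1.le hμ.le
  rw [htail, hpow]
  calc (2 * Real.pi / (α * L)) ^ 2 / P * K 1 + 1 / P ^ (2 * n + 1) * K r
      ≤ (2 * Real.pi / (α * κ)) ^ 2 * (P ^ μ / P ^ (2 * n + 1)) * K 1 +
        P ^ μ / P ^ (2 * n + 1) * K r := by gcongr
    _ = _ := by ring
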